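/- Throughout, a matroid $M=(E,\rho)$ is finite, with rank function $\rho$ and nullity function $\eta(X)=|X|-\rho(X)$ for $X\subseteq E$. It is \emph{binary} if it is isomorphic to the column matroid of a matrix over $\mathbb{F}_2$, and \emph{simple} if it has no loops and no parallel elements. An \emph{isthmus} is an element $e$ with $\rho(E\setminus\{e\})<\rho(E)$. The minimum distance of $M$ is $d=\min\{|X| : X\subseteq E,\ \rho(E\setminus X)<\rho(E)\}$, and $M$ is an $(n,k,d)$-matroid if $|E|=n$, $\rho(E)=k$ and its minimum distance is $d$. A \emph{cyclic flat} is a flat $Z$ with $\rho(Z\setminus\{x\})=\rho(Z)$ for all $x\in Z$. The cyclic flats, ordered by inclusion, form a lattice $\mathcal{Z}(M)$ with bottom element $\mathrm{cl}(\emptyset)$; its \emph{atoms} are the elements covering the bottom, and its \emph{height} is the largest number of elements in a chain (so height 3 means that a longest chain has the form $Z_0\subsetneq Z_1\subsetneq Z_2$). \textbf{Theorem.} Let $M=(E,\rho)$ be a simple binary matroid without isthmuses such that $\mathcal{Z}(M)$ has height $3$. Then either $\eta(E)=2$, or $M$ is isomorphic to the column matroid over $\mathbb{F}_2$ of one of the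 following four matrices, and has the listed parameters and number of atoms of $\mathcal{Z}(M)$: (1) the $(6,3,3)$-matroid, with $4$ atoms, given by $$\begin{pmatrix}1&0&0&1&1&1\\0&1&0&1&0&1\\0&0&1&0&1&1\end{pmatrix};$$ (2) the $(7,3,4)$ simplex matroid, with $7$ atoms, given by $$\begin{pmatrix}1&0&0&1&1&0&1\\0&1&0&1&0&1&1\\0&0&1&0&1&1&1\end{pmatrix};$$ (3) the $(7,4,3)$ Hamming matroid, with $7$ atoms, given by $$\begin{pmatrix}1&0&0&0&1&1&0\\0&1&0&0&1&0&1\\0&0&1&0&0&1&1\\0&0&0&1&1&1&1\end{pmatrix};$$ (4) the $(8,4,4)$ Reed--Muller matroid, with $14$ atoms, given by $$\begin{pmatrix}1&0&0&0&1&0&1&1\\0&1&0&0&1&1&0&1\\0&0&1&0&1&1&1&0\\0&0&0&1&0&1&1&1\end{pmatrix}.$$ Consequently $\eta(E)\le 4$ and $d\le 4$. -/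

import Mathlib

namespace Matroid

/-! ### Rank, nullity, minimum distance, isomorphism -/

/-- The rank `ρ(X)` of a set in a finite matroid, as a natural number. -/
noncomputable def rho {α : Type*} (M : Matroid α) (X : Set α) : ℕ := (M.eRk X).toNat

/-- The nullity `η(X) = |X| - ρ(X)` of a subset `X` of the ground set of a finite matroid. -/
noncomputable def eta {α : Type*} (M : Matroid α) (X : Set α) : ℤ :=
  (X.ncard : ℤ) - (M.rho X : ℤ)

/-- The minimum distance: the least size of a set `X ⊆ E` with `ρ(E - X) < ρ(E)`.
(It is `⊤` if there is no such set, that is, if the rank is zero.) -/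
noncomputable def minDist {α : Type*} (M : Matroid α) : ℕ∞ :=
  sInf {m : ℕ∞ | ∃ X : Set α, X ⊆ M.E ∧ M.rho (M.E \ X) < M.rho M.E ∧ m = X.encard}

/-- An `(n, k, d)`-matroid: `n` elements, rank `k`, minimum distance `d`. -/
def HasParameters {α : Type*} (M : Matroid α) (n k d : ℕ) : Prop :=
  M.E.ncard = n ∧ M.rho M.E = k ∧ M.minDist = (d : ℕ∞)

/-- Two matroids are isomorphic if some bijection of their ground sets preserves ranks. -/
def Isomorphic {α β : Type*} (M : Matroid α) (N : Matroid β) : Prop :=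
  ∃ ψ : M.E ≃ N.E, ∀ X : Set M.E,
    N.rho ((Subtype.val : N.E → β) '' (ψ '' X)) = M.rho ((Subtype.val : M.E → α) '' X)

/-- A matroid is simple if it has no loops (the case `e = f`) and no two parallel elements
(the case `e ≠ f`). -/
def IsSimple {α : Type*} (M : Matroid α) : Prop :=
  ∀ e ∈ M.E, ∀ f ∈ M.E, M.Indep {e, f}

/-! ### Cyclic flats -/

/-- A cyclic flat: a flat `X` with `ρ(X - x) = ρ(X)` for all `x ∈ X`. -/
def IsCyclicFlat {α : Type*} (M : Matroid α) (X : Set α) : Prop :=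
  M.IsFlat X ∧ ∀ x ∈ X, M.rho (X \ {x}) = M.rho X

/-- The poset of cyclic flats, ordered by inclusion. -/
abbrev CyclicFlats {α : Type*} (M : Matroid α) : Type _ := {X : Set α // M.IsCyclicFlat X}

theorem isCyclicFlat_closure_empty {α : Type*} (M : Matroid α) :
    M.IsCyclicFlat (M.closure ∅) := by
  refine ⟨M.isFlat_closure ∅, fun x _ => ?_⟩
  have h : M.eRk (M.closure ∅) = 0 := by simp
  have h' : M.eRk (M.closure ∅ \ {x}) = 0 :=
    le_antisymm (h ▸ M.eRk_mono Set.sdiff_subset) (zero_le)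
  simp only [rho, h, h']

/-- The least cyclic flat is the closure of the empty set. -/
instance instOrderBotCyclicFlats {α : Type*} (M : Matroid α) : OrderBot M.CyclicFlats where
  bot := ⟨M.closure ∅, M.isCyclicFlat_closure_empty⟩
  bot_le Z := Z.2.1.loops_subset

/-- The height of the lattice of cyclic flats: the largest number of elements of a chain. -/
noncomputable def cyclicFlatsHeight {α : Type*} (M : Matroid α) : ℕ∞ :=
  Set.chainHeight (Set.univ : Set M.CyclicFlats) (· < ·)

/-- The number of atoms of the lattice of cyclic flats. -/
noncomputable def numAtoms {α : Type*} (M : Matroid α) : ℕ :=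
  {Z : M.CyclicFlats | IsAtom Z}.ncard

/-! ### Matroids of matrices, binary matroids -/

/-- The matroid of a matrix: its elements are the columns, and a set of columns is independent
if the columns are linearly independent. -/
def ofMatrix {F : Type*} [Field F] {m n : Type*} [Finite n] (G : Matrix m n F) : Matroid n :=
  (IndepMatroid.ofFinite (E := Set.univ) Set.finite_univ
    (fun I => LinearIndepOn F G.col I)
    (linearIndepOn_empty F G.col)
    (fun _ _ hJ hIJ => hJ.mono hIJ)
    (by
      intro I J hI hJ hlt
      by_contra hcon
      push Not at hcon
      have hsub : G.col '' J ⊆ Submodule.span F (G.col '' I) := by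
        rintro _ ⟨e, he, rfl⟩
        by_cases heI : e ∈ I
        · exact Submodule.subset_span ⟨e, heI, rfl⟩
        · by_contra hns
          exact hcon e he heI (hI.insert hns)
      have hfin : (G.col '' I).Finite := (Set.toFinite I).image _
      have : FiniteDimensional F (Submodule.span F (G.col '' I)) :=
        FiniteDimensional.span_of_finite F hfin
      have hle := Submodule.finrank_mono (Submodule.span_le.mpr hsub)
      have key : ∀ K : Set n, LinearIndepOn F G.col K →
          Module.finrank F (Submodule.span F (G.col '' K)) = K.ncard := by
        intro K hK
        have := Fintype.ofFinite K
        have h := finrank_span_eq_card hK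
        rw [← Set.image_eq_range] at h
        rw [h, ← Nat.card_eq_fintype_card, Nat.card_coe_set_eq]
      rw [key I hI, key J hJ] at hle
      omega)
    (fun _ _ => Set.subset_univ _)).matroid

/-- The rank of a set of elements in the matroid of `G` is the rank of the corresponding
submatrix of columns. -/
theorem ofMatrix_rho {F : Type*} [Field F] {m n : Type*} [Finite n]
    (G : Matrix m n F) (X : Set n) :
    (ofMatrix G).rho X = Module.finrank F (Submodule.span F (G.col '' X)) := by
  obtain ⟨I, hI⟩ := (ofMatrix G).exists_isBasis X (Set.subset_univ X)
  have hind : LinearIndepOn F G.col I := hI.indep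
  have hspan : Submodule.span F (G.col '' X) = Submodule.span F (G.col '' I) := by
    apply le_antisymm
    · rw [Submodule.span_le]
      rintro _ ⟨e, he, rfl⟩
      by_cases heI : e ∈ I
      · exact Submodule.subset_span ⟨e, heI, rfl⟩
      · by_contra hns
        have : (ofMatrix G).Indep (insert e I) := hind.insert hns
        exact heI (hI.mem_of_insert_indep he this)
    · exact Submodule.span_mono (Set.image_mono hI.subset)
  have := Fintype.ofFinite I
  have h := finrank_span_eq_card hind
  rw [← Set.image_eq_range] at h
  rw [rho, ← hI.encard_eq_eRk, hspan, h, ← Nat.card_eq_fintype_card, Nat.card_coe_set_eq]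
  rfl

/-- A matroid is binary if it is isomorphic to the matroid of a matrix over `𝔽₂`. -/
def IsBinary {α : Type*} (M : Matroid α) : Prop :=
  ∃ (r n : ℕ) (G : Matrix (Fin r) (Fin n) (ZMod 2)), M.Isomorphic (ofMatrix G)

/-! ### The four matroids -/

/-- The binary `(6, 3, 3)`-matroid. -/
def matroid633 : Matroid (Fin 6) :=
  ofMatrix (!![1, 0, 0, 1, 1, 1;
               0, 1, 0, 1, 0, 1;
               0, 0, 1, 0, 1, 1] : Matrix (Fin 3) (Fin 6) (ZMod 2))

/-- The `(7, 3, 4)` simplex matroid: the columns are all nonzero vectors of `𝔽₂³`. -/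
def simplexMatroid : Matroid (Fin 7) :=
  ofMatrix (!![1, 0, 0, 1, 1, 0, 1;
               0, 1, 0, 1, 0, 1, 1;
               0, 0, 1, 0, 1, 1, 1] : Matrix (Fin 3) (Fin 7) (ZMod 2))

/-- The `(7, 4, 3)` Hamming matroid: the matroid of a generator matrix of the Hamming code. -/
def hammingMatroid : Matroid (Fin 7) :=
  ofMatrix (!![1, 0, 0, 0, 1, 1, 0;
               0, 1, 0, 0, 1, 0, 1;
               0, 0, 1, 0, 0, 1, 1;
               0, 0, 0, 1, 1, 1, 1] : Matrix (Fin 4) (Fin 7) (ZMod 2))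

/-- The `(8, 4, 4)` Reed–Muller matroid: the matroid of a generator matrix of `RM(1, 3)`. -/
def reedMullerMatroid : Matroid (Fin 8) :=
  ofMatrix (!![1, 0, 0, 0, 1, 0, 1, 1;
               0, 1, 0, 0, 1, 1, 0, 1;
               0, 0, 1, 0, 1, 1, 1, 0;
               0, 0, 0, 1, 0, 1, 1, 1] : Matrix (Fin 4) (Fin 8) (ZMod 2))

end Matroid

/-!
The proof rests on one consequence of height three: every nonempty proper cyclic flat `Z` of a
simple binary matroid `M` is a circuit. Indeed no cyclic flat lies strictly between `∅` and `Z`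
(`eq_of_isCyclicFlat_subset`), so a smallest circuit `C ⊆ Z` spans `Z`; an element of `Z` outside
`C` would be the sum of the columns of some `D ⊆ C`, and of those of `C \ D`, which produces a
circuit smaller than `C` because `|C| ≥ 3` (`Represents.isCircuit_of_minimal`).

Hence a proper flat contains at most one circuit, as the union of its circuits is a cyclic flat,
and has nullity at most one. With `k = ρ(E)` and `m = η(E)`, this says that every set whose removal
drops the rank has at least `m` elements (`ncard_ground_le_of_rho_lt`), that is, `m ≤ d`.

Represent `M` by vectors in `𝔽₂ᵏ` such that some basis becomes the unit vectors, and apply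
`m ≤ d` to the coordinates and to the sums of two coordinates. For `m ≥ 3` each coordinate vanishes
on at most one of the `m` non-unit vectors, and two coordinates differ on at least `m - 2` of them,
while they can differ on at most two. Thus `m ≤ 4`, and counting leaves `k ≤ 4`; there are
at most `2ᵏ - 1` vectors, so `k ≥ 3` (`parameters_of_weights`).

- For `k = 3` the vectors are all the nonzero ones, or all but one. The missing one can be moved
  to a prescribed place by a linear map.
- For `k = 4` every non-unit vector is the complement of a unit vector, and all four complements
  occur, or all but one.

These are the four matroids. Their distance is `m`, attained by a row of the matrix. The atoms
are the nonempty proper cyclic flats, which are counted on the matrix. For `m = 2` the bound on the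
distance is the Singleton bound `d ≤ m + 1`; `m < 2` is impossible, since deleting an element
outside a nonempty proper cyclic flat, and then one inside, does not lower the rank.
-/

namespace Matroid

/-! ### Rank and cyclic flats -/

section Rank
variable {α : Type*} {M : Matroid α} {X Y Z F C : Set α} {e : α}

lemma cast_rho (M : Matroid α) [M.Finite] (X : Set α) : (M.rho X : ℕ∞) = M.eRk X :=
  ENat.natCast_toNat (eRk_lt_top_iff.2 (M.isRkFinite_set X)).ne

lemma rho_le_rho [M.Finite] (h : X ⊆ Y) : M.rho X ≤ M.rho Y := by
  have := M.eRk_mono h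
  rw [← cast_rho, ← cast_rho] at this
  exact_mod_cast this

lemma rho_insert_eq_iff [M.Finite] (he : e ∈ M.E) :
    M.rho (insert e X) = M.rho X ↔ e ∈ M.closure X := by
  constructor
  · intro h
    by_contra hcl
    have := eRk_insert_eq_add_one ⟨he, hcl⟩
    rw [← cast_rho, ← cast_rho] at this
    norm_cast at this
    omega
  · intro h
    rw [rho, rho, ← eRk_closure_eq, closure_insert_eq_of_mem_closure h, eRk_closure_eq]

lemma rho_closure (M : Matroid α) (X : Set α) : M.rho (M.closure X) = M.rho X := by
  rw [rho, rho, eRk_closure_eq]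

lemma indep_iff_rho [M.Finite] (hX : X ⊆ M.E) : M.Indep X ↔ M.rho X = X.ncard := by
  have hf := M.ground_finite.subset hX
  rw [indep_iff_eRk_eq_encard_of_finite hf, ← cast_rho, ← hf.cast_ncard_eq]
  norm_cast

lemma rho_le_ncard [M.Finite] (hX : X ⊆ M.E) : M.rho X ≤ X.ncard := by
  have hf := M.ground_finite.subset hX
  have := M.eRk_le_encard X
  rw [← cast_rho, ← hf.cast_ncard_eq] at this
  exact_mod_cast this

/-- A flat is cyclic if and only if it is a union of circuits. -/
lemma isCyclicFlat_iff [M.Finite] :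
    M.IsCyclicFlat Z ↔ M.IsFlat Z ∧ ∀ x ∈ Z, ∃ C ⊆ Z, M.IsCircuit C ∧ x ∈ C := by
  refine and_congr_right fun hZ => forall₂_congr fun x hx => ?_
  have hZE := hZ.subset_ground
  rw [eq_comm]
  nth_rw 1 [← Set.insert_sdiff_self_of_mem hx]
  rw [rho_insert_eq_iff (hZE hx),
    mem_closure_iff_exists_isCircuit (by simp)]
  constructor
  · rintro ⟨C, h1, h2, h3⟩
    rw [Set.insert_sdiff_self_of_mem hx] at h1
    exact ⟨C, h1, h2, h3⟩
  · rintro ⟨C, h1, h2, h3⟩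
    refine ⟨C, ?_, h2, h3⟩
    rwa [Set.insert_sdiff_self_of_mem hx]



lemma isCyclicFlat_closure_isCircuit [M.Finite] (hC : M.IsCircuit C) :
    M.IsCyclicFlat (M.closure C) := by
  refine isCyclicFlat_iff.2 ⟨M.isFlat_closure C, fun x hx => ?_⟩
  by_cases hxC : x ∈ C
  · exact ⟨C, M.subset_closure C hC.subset_ground, hC, hxC⟩
  · obtain ⟨D, hD, h1, h2⟩ := exists_isCircuit_of_mem_closure hx hxC
    exact ⟨D, hD.trans (Set.insert_subset hx (M.subset_closure C hC.subset_ground)), h1, h2⟩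

/-- The union of the circuits contained in a flat is a cyclic flat. -/
lemma isCyclicFlat_biUnion_isCircuit [M.Finite] (hF : M.IsFlat F) :
    M.IsCyclicFlat (⋃₀ {C | M.IsCircuit C ∧ C ⊆ F}) := by
  have hsub : ⋃₀ {C | M.IsCircuit C ∧ C ⊆ F} ⊆ F := Set.sUnion_subset fun C hC => hC.2
  refine isCyclicFlat_iff.2 ⟨?_, ?_⟩
  · refine isFlat_iff_closure_eq.2 (Set.Subset.antisymm (fun x hx => ?_)
      (M.subset_closure _ (hsub.trans hF.subset_ground)))
    by_contra hxZ
    obtain ⟨C, h1, h2, h3⟩ := exists_isCircuit_of_mem_closure hx hxZ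
    have hxF : x ∈ F := hF.closure ▸ M.closure_subset_closure hsub hx
    exact hxZ ⟨C, ⟨h2, h1.trans (Set.insert_subset hxF hsub)⟩, h3⟩
  · rintro x ⟨C, hC, hxC⟩
    exact ⟨C, Set.subset_sUnion_of_mem hC, hC.1, hxC⟩

lemma isCyclicFlat_ground [M.Finite] (hcol : ∀ e, ¬ M.IsColoop e) : M.IsCyclicFlat M.E := by
  refine isCyclicFlat_iff.2 ⟨M.ground_isFlat, fun x hx => ?_⟩
  obtain ⟨C, hC, hxC⟩ : ∃ C, M.IsCircuit C ∧ x ∈ C := by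
    by_contra! h
    exact hcol x ((isColoop_iff_forall_notMem_isCircuit hx).2 h)
  exact ⟨C, hC.subset_ground, hC, hxC⟩

end Rank

/-! ### Cyclic flats in height three -/

section Height
variable {α : Type*} {M : Matroid α} {X Y Z F C D : Set α} {e : α}

lemma closure_empty_of_isSimple (hs : M.IsSimple) : M.closure ∅ = ∅ := by
  refine Set.eq_empty_of_forall_notMem fun e he => ?_
  have heE := mem_ground_of_mem_closure he
  have := hs e heE e heE
  rw [Set.pair_eq_singleton, indep_singleton] at this
  exact this.not_isLoop he

lemma bot_val_of_isSimple (hs : M.IsSimple) : ((⊥ : M.CyclicFlats) : Set α) = ∅ :=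
  closure_empty_of_isSimple hs

lemma three_le_ncard_isCircuit [M.Finite] (hs : M.IsSimple) (hC : M.IsCircuit C) :
    3 ≤ C.ncard := by
  by_contra! h
  obtain ⟨e, he⟩ := hC.nonempty
  have hf := M.ground_finite.subset hC.subset_ground
  have h1 : (C \ {e}).ncard ≤ 1 := by
    have := Set.ncard_sdiff_singleton_add_one he hf
    omega
  refine hC.not_indep ?_
  rcases Set.ncard_le_one_iff_eq (hf.subset Set.sdiff_subset) |>.1 h1 with h0 | ⟨f, hf⟩
  · rw [← Set.insert_sdiff_self_of_mem he, h0]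
    simpa using hs e (hC.subset_ground he) e (hC.subset_ground he)
  · rw [← Set.insert_sdiff_self_of_mem he, hf]
    exact hs e (hC.subset_ground he) f (hC.subset_ground
      (Set.sdiff_subset (hf ▸ Set.mem_singleton f : f ∈ C \ {e})))

/-- In height three, a cyclic flat strictly between the bottom and the ground set has no
nonempty cyclic flat strictly below it. -/
lemma eq_of_isCyclicFlat_subset [M.Finite] (hs : M.IsSimple) (hcol : ∀ e, ¬ M.IsColoop e)
    (hh : M.cyclicFlatsHeight = 3) (hY : M.IsCyclicFlat Y) (hZ : M.IsCyclicFlat Z)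
    (hYZ : Y ⊆ Z) (hne : Y.Nonempty) (hZE : Z ≠ M.E) : Y = Z := by
  by_contra hlt
  let a : M.CyclicFlats := ⊥
  let b : M.CyclicFlats := ⟨Y, hY⟩
  let c : M.CyclicFlats := ⟨Z, hZ⟩
  let d : M.CyclicFlats := ⟨M.E, isCyclicFlat_ground hcol⟩
  have hab : a < b := by
    refine bot_lt_iff_ne_bot.2 fun h => ?_
    have := congrArg Subtype.val h
    rw [bot_val_of_isSimple hs] at this
    exact hne.ne_empty this
  have hbc : b < c := Subtype.mk_lt_mk.2 (hYZ.ssubset_of_ne hlt)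
  have hcd : c < d := Subtype.mk_lt_mk.2 (hZ.1.subset_ground.ssubset_of_ne hZE)
  have hch : IsChain (· < ·) ({a, b, c, d} : Set M.CyclicFlats) := by
    have := hab.trans hbc
    have := hbc.trans hcd
    have := hab.trans this
    rintro x (rfl | rfl | rfl | rfl) y (rfl | rfl | rfl | rfl) hxy <;> simp_all
  have h4 : ({a, b, c, d} : Set M.CyclicFlats).encard = 4 := by
    have h1 := hab.trans hbc
    have h2 := hbc.trans hcd
    have h3 := hab.trans h2
    rw [Set.encard_insert_of_notMem, Set.encard_insert_of_notMem, Set.encard_insert_of_notMem,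
      Set.encard_singleton]
    · norm_num
    · simpa using hcd.ne
    · simpa using ⟨hbc.ne, h2.ne⟩
    · simpa using ⟨hab.ne, h1.ne, h3.ne⟩
  have := Set.encard_le_chainHeight_of_isChain Set.univ _ (Set.subset_univ _) hch
  rw [h4] at this
  unfold cyclicFlatsHeight at hh
  rw [hh] at this
  exact absurd this (by decide)

/-- In height three there is a cyclic flat strictly between the bottom and the ground set. -/
lemma exists_isCyclicFlat
    (hh : M.cyclicFlatsHeight = 3) : ∃ Z, M.IsCyclicFlat Z ∧ Z.Nonempty ∧ Z ≠ M.E := by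
  by_contra! hno
  obtain ⟨t, -, h3, -⟩ := Set.exists_isChain_of_le_chainHeight (r := (· < ·))
    (s := (Set.univ : Set M.CyclicFlats)) 3 hh.ge
  have hsub : Subtype.val '' t ⊆ ({∅, M.E} : Set (Set α)) := by
    rintro _ ⟨z, -, rfl⟩
    rcases z.1.eq_empty_or_nonempty with h | h
    · exact Or.inl h
    · exact Or.inr (hno z.1 z.2 h)
  have := (Set.encard_le_encard hsub).trans (Set.encard_insert_le _ _)
  rw [Subtype.val_injective.encard_image, h3, Set.encard_singleton] at this
  exact absurd this (by decide)

/-- The atoms are exactly the cyclic flats other than the bottom and the ground set. -/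
lemma numAtoms_eq [M.Finite] (hs : M.IsSimple) (hcol : ∀ e, ¬ M.IsColoop e)
    (hh : M.cyclicFlatsHeight = 3) :
    M.numAtoms = {Z | M.IsCyclicFlat Z ∧ Z.Nonempty ∧ Z ≠ M.E}.ncard := by
  rw [numAtoms, ← Set.ncard_image_of_injective _ Subtype.val_injective]
  congr 1
  ext Z
  constructor
  · rintro ⟨z, hz, rfl⟩
    have hne : z.1.Nonempty := by
      rw [Set.nonempty_iff_ne_empty, ← bot_val_of_isSimple hs]
      exact fun h => hz.1 (Subtype.ext h)
    refine ⟨z.2, hne, fun hE => ?_⟩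
    obtain ⟨Y, hY, hY1, hY2⟩ := exists_isCyclicFlat hh
    have : (⟨Y, hY⟩ : M.CyclicFlats) < z :=
      Subtype.mk_lt_mk.2 (hE ▸ hY.1.subset_ground.ssubset_of_ne hY2)
    have := congrArg Subtype.val (hz.2 _ this)
    rw [bot_val_of_isSimple hs] at this
    exact hY1.ne_empty this
  · rintro ⟨hZ, hne, hE⟩
    refine ⟨⟨Z, hZ⟩, ⟨fun h => ?_, fun y hy => ?_⟩, rfl⟩
    · have := congrArg Subtype.val h
      rw [bot_val_of_isSimple hs] at this
      exact hne.ne_empty this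
    · by_contra hy0
      have hyne : y.1.Nonempty := by
        rw [Set.nonempty_iff_ne_empty, ← bot_val_of_isSimple hs]
        exact fun h => hy0 (Subtype.ext h)
      have : y.1 = Z := eq_of_isCyclicFlat_subset hs hcol hh y.2 hZ hy.le hyne hE
      exact hy.ne (Subtype.ext this)

end Height

/-! ### Matroids whose proper cyclic flats are circuits -/

section CircuitFlats
variable {α : Type*} {M : Matroid α} {X Y Z F C D : Set α} {e : α}

/-- If all nonempty proper cyclic flats are circuits, then a proper flat contains at most one
circuit: the union of the circuits in it is a cyclic flat, hence itself a circuit. -/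
lemma isCircuit_unique_of_isFlat [M.Finite]
    (h : ∀ Z, M.IsCyclicFlat Z → Z.Nonempty → Z ≠ M.E → M.IsCircuit Z)
    (hF : M.IsFlat F) (hFE : F ≠ M.E) (hC : M.IsCircuit C) (hD : M.IsCircuit D)
    (hCF : C ⊆ F) (hDF : D ⊆ F) : C = D := by
  have hsub : ⋃₀ {C | M.IsCircuit C ∧ C ⊆ F} ⊆ F := Set.sUnion_subset fun C hC => hC.2
  have hCU : C ⊆ ⋃₀ {C | M.IsCircuit C ∧ C ⊆ F} := Set.subset_sUnion_of_mem ⟨hC, hCF⟩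
  have hDU : D ⊆ ⋃₀ {C | M.IsCircuit C ∧ C ⊆ F} := Set.subset_sUnion_of_mem ⟨hD, hDF⟩
  have hZ := h _ (isCyclicFlat_biUnion_isCircuit hF) (hC.nonempty.mono hCU)
    fun hE => hFE (hF.subset_ground.antisymm (hE ▸ hsub))
  rw [hC.eq_of_subset_isCircuit hZ hCU, hD.eq_of_subset_isCircuit hZ hDU]

/-- A set containing at most one circuit has nullity at most one: deleting an element of that
circuit leaves an independent set. -/
lemma ncard_le_rho_add_one [M.Finite] (hXE : X ⊆ M.E)
    (h : ∀ C D, M.IsCircuit C → M.IsCircuit D → C ⊆ X → D ⊆ X → C = D) :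
    X.ncard ≤ M.rho X + 1 := by
  have hf := M.ground_finite.subset hXE
  rcases M.indep_or_dep hXE with hi | hd
  · rw [(indep_iff_rho hXE).1 hi]
    omega
  · obtain ⟨C, hCX, hC⟩ := hd.exists_isCircuit_subset
    obtain ⟨e, he⟩ := hC.nonempty
    have hi : M.Indep (X \ {e}) := by
      refine (indep_iff_forall_subset_not_isCircuit (Set.sdiff_subset.trans hXE)).2
        fun D hDX hD => ?_
      have := h C D hC hD hCX (hDX.trans Set.sdiff_subset)
      exact (hDX (this ▸ he)).2 rfl
    have h1 := (indep_iff_rho hi.subset_ground).1 hi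
    have h2 := M.rho_le_rho (Set.sdiff_subset : X \ {e} ⊆ X)
    have h3 := Set.ncard_sdiff_singleton_add_one (hCX he) hf
    omega

/-- If all nonempty proper cyclic flats are circuits, then the minimum distance is at least the
nullity of the matroid. -/
lemma ncard_ground_le_of_rho_lt [M.Finite]
    (h : ∀ Z, M.IsCyclicFlat Z → Z.Nonempty → Z ≠ M.E → M.IsCircuit Z)
    (hX : X ⊆ M.E) (hlt : M.rho (M.E \ X) < M.rho M.E) :
    M.E.ncard ≤ M.rho M.E + X.ncard := by
  have hEX : M.E \ X ⊆ M.E := Set.sdiff_subset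
  have hF : M.closure (M.E \ X) ≠ M.E := fun hE => by
    rw [← rho_closure, hE] at hlt
    exact hlt.ne rfl
  have hsub := M.subset_closure (M.E \ X) hEX
  have h1 := ncard_le_rho_add_one hEX fun C D hC hD hCX hDX =>
    isCircuit_unique_of_isFlat h (M.isFlat_closure _) hF hC hD (hCX.trans hsub) (hDX.trans hsub)
  have h2 := Set.ncard_sdiff_add_ncard_of_subset hX M.ground_finite
  omega

/-- If there is a cyclic flat strictly between the bottom and the ground set, the nullity is at
least two: deleting an element outside the flat, and then one inside, preserves the rank. -/
lemma two_le_nullity [M.Finite] (hcol : ∀ e, ¬ M.IsColoop e) (hZ : M.IsCyclicFlat Z)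
    (hne : Z.Nonempty) (hZE : Z ≠ M.E) : M.rho M.E + 2 ≤ M.E.ncard := by
  obtain ⟨e, he, heZ⟩ := Set.exists_of_ssubset (hZ.1.subset_ground.ssubset_of_ne hZE)
  obtain ⟨x, hx⟩ := hne
  obtain ⟨C, hCZ, hC, hxC⟩ := (isCyclicFlat_iff.1 hZ).2 x hx
  have hxE := hC.subset_ground hxC
  obtain ⟨D, hDE, hD, heD⟩ := (isCyclicFlat_iff.1 (isCyclicFlat_ground hcol)).2 e he
  have hxe : x ≠ e := fun h => heZ (h ▸ hx)
  have hxEe : x ∈ M.E \ {e} := ⟨hxE, hxe⟩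
  have h1 : M.rho (insert e (M.E \ {e})) = M.rho (M.E \ {e}) :=
    (rho_insert_eq_iff he).2 <| (mem_closure_iff_exists_isCircuit (by simp)).2
      ⟨D, by rwa [Set.insert_sdiff_self_of_mem he], hD, heD⟩
  have h2 : M.rho (insert x ((M.E \ {e}) \ {x})) = M.rho ((M.E \ {e}) \ {x}) := by
    refine (rho_insert_eq_iff hxE).2 <| (mem_closure_iff_exists_isCircuit (by simp)).2
      ⟨C, ?_, hC, hxC⟩
    rw [Set.insert_sdiff_self_of_mem hxEe]
    exact fun y hy => ⟨hC.subset_ground hy, fun h => heZ (h ▸ hCZ hy)⟩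
  rw [Set.insert_sdiff_self_of_mem he] at h1
  rw [Set.insert_sdiff_self_of_mem hxEe] at h2
  have h3 := rho_le_ncard (M := M) (X := (M.E \ {e}) \ {x}) (by tauto_set)
  have h4 := Set.ncard_sdiff_singleton_add_one he M.ground_finite
  have h5 := Set.ncard_sdiff_singleton_add_one (a := x) (s := M.E \ {e}) ⟨hxE, hxe⟩
    (M.ground_finite.subset Set.sdiff_subset)
  omega

end CircuitFlats

/-! ### Representations over `𝔽₂` -/

section Represents
variable {α : Type*} {M : Matroid α} {X Y Z C D : Set α} {e f : α}
  {V W : Type*} [AddCommGroup V] [Module (ZMod 2) V] [AddCommGroup W] [Module (ZMod 2) W]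

/-- A family of vectors over `𝔽₂` represents `M` if it has the same rank as `M` on every subset of
the ground set. Elements outside the ground set may carry arbitrary vectors. -/
def Represents (M : Matroid α) (v : α → V) : Prop :=
  ∀ X ⊆ M.E, M.rho X = Module.finrank (ZMod 2) (Submodule.span (ZMod 2) (v '' X))

lemma IsBinary.exists_represents (h : M.IsBinary) :
    ∃ (r : ℕ) (v : α → Fin r → ZMod 2), M.Represents v := by
  classical
  obtain ⟨r, n, G, ψ, hψ⟩ := h
  refine ⟨r, fun e => if he : e ∈ M.E then G.col (ψ ⟨e, he⟩) else 0, fun X hX => ?_⟩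
  have h1 : (Subtype.val : M.E → α) '' (Subtype.val ⁻¹' X) = X := by
    simpa [Subtype.image_preimage_coe] using hX
  have h2 := hψ (Subtype.val ⁻¹' X)
  rw [h1, ofMatrix_rho] at h2
  rw [← h2]
  refine congrArg (fun S => Module.finrank (ZMod 2) (Submodule.span (ZMod 2) S)) ?_
  ext x
  constructor
  · rintro ⟨_, ⟨_, ⟨e, he, rfl⟩, rfl⟩, rfl⟩
    exact ⟨e, he, dif_pos e.2⟩
  · rintro ⟨e, he, rfl⟩
    exact ⟨_, ⟨_, ⟨⟨e, hX he⟩, he, rfl⟩, rfl⟩, by simp [hX he]⟩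

lemma Represents.of_injective {v : α → V} {w : α → W} (hv : M.Represents v)
    (T : W →ₗ[ZMod 2] V) (hT : Function.Injective T) (h : ∀ e ∈ M.E, v e = T (w e)) :
    M.Represents w := by
  intro X hX
  have h1 : v '' X = T '' (w '' X) := by
    rw [Set.image_image]
    exact Set.image_congr fun e he => h e (hX he)
  rw [hv X hX, h1, Submodule.span_image]
  exact (Submodule.equivMapOfInjective T hT _).finrank_eq.symm

variable {v : α → V}

lemma Represents.linearIndepOn [M.Finite] (hv : M.Represents v) (hX : M.Indep X) :
    LinearIndepOn (ZMod 2) v X := by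
  have hf := M.ground_finite.subset hX.subset_ground
  have := hf.fintype
  have h := hv X hX.subset_ground
  rw [(indep_iff_rho hX.subset_ground).1 hX, Set.image_eq_range] at h
  refine linearIndependent_iff_card_eq_finrank_span.2 ?_
  rw [Set.finrank]
  convert h
  rw [← Nat.card_eq_fintype_card, Nat.card_coe_set_eq]

/-- Over `𝔽₂`, a linear combination is a subset sum. -/
lemma exists_sum_eq_of_mem_span {x : V} (hx : x ∈ Submodule.span (ZMod 2) (v '' X)) :
    ∃ D : Finset α, (D : Set α) ⊆ X ∧ x = ∑ i ∈ D, v i := by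
  obtain ⟨l, hl, rfl⟩ := (Finsupp.mem_span_image_iff_linearCombination (ZMod 2)).1 hx
  refine ⟨l.support, hl, Finset.sum_congr rfl fun i hi => ?_⟩
  have h01 : ∀ a : ZMod 2, a ≠ 0 → a = 1 := by decide
  simp [h01 _ (Finsupp.mem_support_iff.1 hi)]

lemma mem_span_sdiff_of_sum_eq_zero {D : Finset α} (h : ∑ i ∈ D, v i = 0) (he : e ∈ D) :
    v e ∈ Submodule.span (ZMod 2) (v '' ((D : Set α) \ {e})) := by
  classical
  rw [← Finset.add_sum_erase _ _ he] at h
  rw [eq_neg_of_add_eq_zero_left h]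
  refine Submodule.neg_mem _ (Submodule.sum_mem _ fun i hi => Submodule.subset_span ⟨i, ?_, rfl⟩)
  have := Finset.mem_erase.1 hi
  exact ⟨this.2, this.1⟩

variable [Module.Finite (ZMod 2) V]

lemma Represents.mem_closure_iff [M.Finite] (hv : M.Represents v) (he : e ∈ M.E) (hX : X ⊆ M.E) :
    e ∈ M.closure X ↔ v e ∈ Submodule.span (ZMod 2) (v '' X) := by
  rw [← rho_insert_eq_iff he, hv _ hX, hv _ (Set.insert_subset he hX), Set.image_insert_eq]
  constructor
  · intro h
    have := Submodule.eq_of_le_of_finrank_eq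
      (Submodule.span_mono (R := ZMod 2) (Set.subset_insert (v e) (v '' X))) h.symm
    rw [this]
    exact Submodule.subset_span (Set.mem_insert _ _)
  · intro h
    rw [Submodule.span_insert_eq_span h]

lemma Represents.ne_zero [M.Finite] (hv : M.Represents v) (hs : M.IsSimple) (he : e ∈ M.E) :
    v e ≠ 0 := by
  intro h0
  have := (hv.mem_closure_iff he (Set.empty_subset _)).2 (by rw [h0]; exact Submodule.zero_mem _)
  rw [closure_empty_of_isSimple hs] at this
  exact this

lemma Represents.injOn [M.Finite] (hv : M.Represents v) (hs : M.IsSimple) :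
    Set.InjOn v M.E := by
  intro e he f hf hef
  by_contra hne
  have h1 : e ∈ M.closure {f} := (hv.mem_closure_iff he (by simpa using hf)).2
    (by rw [hef]; exact Submodule.subset_span ⟨f, rfl, rfl⟩)
  have h2 := (hs e he f hf).notMem_closure_sdiff_of_mem (Set.mem_insert e {f})
  rw [Set.insert_sdiff_self_of_notMem (by simpa using hne)] at h2
  exact h2 h1

lemma Represents.dep_of_sum_eq_zero [M.Finite] (hv : M.Represents v) {D : Finset α}
    (hD : (D : Set α) ⊆ M.E) (h : ∑ i ∈ D, v i = 0) (hne : D.Nonempty) : M.Dep (D : Set α) := by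
  obtain ⟨e, he⟩ := hne
  refine ⟨fun hi => hi.notMem_closure_sdiff_of_mem (e := e) he ?_, hD⟩
  exact (hv.mem_closure_iff (hD he) (Set.sdiff_subset.trans hD)).2
    (mem_span_sdiff_of_sum_eq_zero h he)

lemma Represents.sum_eq_zero_of_isCircuit [M.Finite] (hv : M.Represents v) {C : Finset α}
    (hC : M.IsCircuit (C : Set α)) : ∑ i ∈ C, v i = 0 := by
  classical
  obtain ⟨e, he⟩ := hC.nonempty
  have hCE := hC.subset_ground
  have h1 := (hv.mem_closure_iff (hCE he) (Set.sdiff_subset.trans hCE)).1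
    (hC.mem_closure_sdiff_singleton_of_mem he)
  obtain ⟨D, hD, hsum⟩ := exists_sum_eq_of_mem_span h1
  have heD : e ∉ D := fun h => (hD h).2 rfl
  have h2 : ∑ i ∈ insert e D, v i = 0 := by
    rw [Finset.sum_insert heD, ← hsum, ZModModule.add_self]
  have hsub : ((insert e D : Finset α) : Set α) ⊆ C := by
    rw [Finset.coe_insert]
    exact Set.insert_subset he (hD.trans Set.sdiff_subset)
  have h3 := hC.eq_of_dep_subset
    (hv.dep_of_sum_eq_zero (hsub.trans hCE) h2 (Finset.insert_nonempty _ _)) hsub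
  rw [← Finset.coe_injective h3]
  exact h2

/-- In a simple binary matroid, a cyclic flat with no smaller nonempty cyclic flat is a circuit.
Let `C` be a smallest circuit in it; it spans the flat. An element `e` outside `C` would be the
sum of some `D ⊆ C`, so that `D ∪ {e}` and `(C \ D) ∪ {e}` are both dependent, and one of them
has fewer elements than `C`. -/
lemma Represents.isCircuit_of_minimal [M.Finite] (hv : M.Represents v) (hs : M.IsSimple)
    (hZ : M.IsCyclicFlat Z) (hne : Z.Nonempty)
    (hmin : ∀ Y, M.IsCyclicFlat Y → Y ⊆ Z → Y.Nonempty → Y = Z) : M.IsCircuit Z := by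
  classical
  have hZE := hZ.1.subset_ground
  have hZf := M.ground_finite.subset hZE
  obtain ⟨x, hx⟩ := hne
  obtain ⟨C₀, hC₀Z, hC₀, -⟩ := (isCyclicFlat_iff.1 hZ).2 x hx
  obtain ⟨C, ⟨hCZ, hC⟩, hCmin⟩ := Set.exists_min_image {C | C ⊆ Z ∧ M.IsCircuit C} Set.ncard
    (hZf.finite_subsets.subset fun C hC => hC.1) ⟨C₀, hC₀Z, hC₀⟩
  have hdep : ∀ D : Finset α, (D : Set α) ⊆ Z → D.Nonempty → ∑ i ∈ D, v i = 0 →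
      C.ncard ≤ D.card := by
    intro D hDZ hDne hD
    obtain ⟨C', h1, h2⟩ :=
      (hv.dep_of_sum_eq_zero (hDZ.trans hZE) hD hDne).exists_isCircuit_subset
    refine (hCmin C' ⟨h1.trans hDZ, h2⟩).trans ?_
    rw [← Set.ncard_coe_finset D]
    exact Set.ncard_le_ncard h1 D.finite_toSet
  have hcl : M.closure C = Z := by
    refine hmin _ (isCyclicFlat_closure_isCircuit hC) ?_
      (hC.nonempty.mono (M.subset_closure C hC.subset_ground))
    rw [← hZ.1.closure]
    exact M.closure_subset_closure hCZ
  suffices Z ⊆ C by rwa [this.antisymm hCZ]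
  intro e heZ
  by_contra heC
  obtain ⟨C', rfl⟩ := (hZf.subset hCZ).exists_finset_coe
  have h0 := hv.sum_eq_zero_of_isCircuit hC
  have h3 := three_le_ncard_isCircuit hs hC
  obtain ⟨D, hDC, hD⟩ := exists_sum_eq_of_mem_span
    ((hv.mem_closure_iff (hZE heZ) hC.subset_ground).1 (hcl ▸ heZ))
  have hDC' : D ⊆ C' := by exact_mod_cast hDC
  have heC' : e ∉ C' := heC
  have hD2 : v e = ∑ i ∈ C' \ D, v i := by
    rw [← Finset.sum_sdiff hDC', ← hD] at h0
    rw [eq_neg_of_add_eq_zero_left h0, ZModModule.neg_eq_self]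
  have key : ∀ D ⊆ C', v e = ∑ i ∈ D, v i → C'.card ≤ D.card + 1 := by
    intro D hDC hD
    have heD : e ∉ D := fun h => heC' (hDC h)
    rw [← Finset.card_insert_of_notMem heD, ← Set.ncard_coe_finset C']
    refine hdep _ ?_ (Finset.insert_nonempty _ _) ?_
    · rw [Finset.coe_insert]
      exact Set.insert_subset heZ ((Finset.coe_subset.2 hDC).trans hCZ)
    · rw [Finset.sum_insert heD, ← hD, ZModModule.add_self]
  have k1 := key D hDC' hD
  have k2 := key (C' \ D) Finset.sdiff_subset hD2
  have k3 := Finset.card_sdiff_add_card_eq_card hDC'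
  rw [Set.ncard_coe_finset] at h3
  omega

/-- A proper nonempty cyclic flat is recognized on a representation: it is the support of a
relation, and each element outside it is separated from it by a linear functional. -/
lemma Represents.isCyclicFlat_iff_of_forall_isCircuit [M.Finite] (hv : M.Represents v)
    (h : ∀ Z, M.IsCyclicFlat Z → Z.Nonempty → Z ≠ M.E → M.IsCircuit Z) (D : Finset α)
    (hDE : (D : Set α) ⊆ M.E) :
    (M.IsCyclicFlat (D : Set α) ∧ (D : Set α).Nonempty ∧ (D : Set α) ≠ M.E) ↔
      (∑ i ∈ D, v i = 0 ∧ (D : Set α).Nonempty ∧ (D : Set α) ≠ M.E ∧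
        ∀ e ∈ M.E, e ∉ D → ∃ φ : V →ₗ[ZMod 2] ZMod 2, (∀ x ∈ D, φ (v x) = 0) ∧ φ (v e) ≠ 0) := by
  constructor
  · rintro ⟨h1, h2, h3⟩
    refine ⟨hv.sum_eq_zero_of_isCircuit (h _ h1 h2 h3), h2, h3, fun e he heD => ?_⟩
    have : v e ∉ Submodule.span (ZMod 2) (v '' (D : Set α)) := by
      rw [← hv.mem_closure_iff he hDE, h1.1.closure]
      exact heD
    obtain ⟨φ, hφ, hle⟩ := Submodule.exists_le_ker_of_notMem this
    exact ⟨φ, fun x hx => hle (Submodule.subset_span ⟨x, hx, rfl⟩), hφ⟩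
  · rintro ⟨h1, h2, h3, h4⟩
    refine ⟨⟨?_, fun x hx => ?_⟩, h2, h3⟩
    · refine isFlat_iff_closure_eq.2 (Set.Subset.antisymm (fun e he => ?_) (M.subset_closure _ hDE))
      by_contra heD
      have heE := mem_ground_of_mem_closure he
      obtain ⟨φ, hφ, hφe⟩ := h4 e heE heD
      have hle : Submodule.span (ZMod 2) (v '' (D : Set α)) ≤ LinearMap.ker φ := by
        rw [Submodule.span_le]
        rintro _ ⟨x, hx, rfl⟩
        exact hφ x hx
      exact hφe (hle ((hv.mem_closure_iff heE hDE).1 he))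
    · have hcl := (hv.mem_closure_iff (hDE hx) (Set.sdiff_subset.trans hDE)).2
        (mem_span_sdiff_of_sum_eq_zero h1 hx)
      rw [← rho_insert_eq_iff (hDE hx), Set.insert_sdiff_self_of_mem hx] at hcl
      exact hcl.symm

/-- A functional that does not vanish on all of the represented elements drops the rank. -/
lemma Represents.rho_lt_of_functional [M.Finite] (hv : M.Represents v)
    (φ : V →ₗ[ZMod 2] ZMod 2) (he : e ∈ M.E) (hφ : φ (v e) ≠ 0) :
    M.rho (M.E \ {x ∈ M.E | φ (v x) ≠ 0}) < M.rho M.E := by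
  rw [hv _ Set.sdiff_subset, hv _ subset_rfl]
  refine Submodule.finrank_lt_finrank_of_lt
    ((Submodule.span_mono (Set.image_mono Set.sdiff_subset)).lt_of_not_ge fun hle => hφ ?_)
  have : Submodule.span (ZMod 2) (v '' (M.E \ {x ∈ M.E | φ (v x) ≠ 0})) ≤ LinearMap.ker φ := by
    rw [Submodule.span_le]
    rintro _ ⟨x, hx, rfl⟩
    by_contra h0
    exact hx.2 ⟨hx.1, h0⟩
  exact this (hle (Submodule.subset_span ⟨e, he, rfl⟩))

/-- Every binary matroid of rank `k` has a representation in `𝔽₂ᵏ` in which the elements of some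
basis are the unit vectors. -/
lemma Represents.exists_systematic [M.Finite] (hv : M.Represents v) {k : ℕ}
    (hk : M.rho M.E = k) :
    ∃ w : α → Fin k → ZMod 2, M.Represents w ∧ ∀ i, ∃ e ∈ M.E, w e = Pi.single i 1 := by
  classical
  subst hk
  obtain ⟨I, hI⟩ := M.exists_isBase
  have hIf := M.ground_finite.subset hI.subset_ground
  have := hIf.fintype
  have hIr : M.rho M.E = Fintype.card I := by
    rw [← Nat.card_eq_fintype_card, Nat.card_coe_set_eq,
      ← (indep_iff_rho hI.subset_ground).1 hI.indep, ← rho_closure _ I, hI.closure_eq]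
  let b : Fin (M.rho M.E) ≃ I := (Fintype.equivFinOfCardEq hIr.symm).symm
  have hli : LinearIndependent (ZMod 2) fun i => v (b i) :=
    (hv.linearIndepOn hI.indep).linearIndependent.comp b b.injective
  let T : (Fin (M.rho M.E) → ZMod 2) →ₗ[ZMod 2] V :=
    Fintype.linearCombination (ZMod 2) fun i => v (b i)
  have hTs : ∀ i, T (Pi.single i 1) = v (b i) := fun i => by
    simp [T, Fintype.linearCombination_apply_single]
  have hTinj : Function.Injective T := hli.fintypeLinearCombination_injective
  obtain ⟨L, hL⟩ := T.exists_leftInverse_of_injective (LinearMap.ker_eq_bot.2 hTinj)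
  have hLT : ∀ x, L (T x) = x := fun x => LinearMap.congr_fun hL x
  refine ⟨fun e => L (v e), hv.of_injective T hTinj fun e he => ?_, fun i => ?_⟩
  · have h1 : v e ∈ Submodule.span (ZMod 2) (v '' I) :=
      (hv.mem_closure_iff he hI.subset_ground).1 (hI.closure_eq ▸ he)
    have h2 : Submodule.span (ZMod 2) (v '' I) ≤ LinearMap.range T := by
      rw [Submodule.span_le]
      rintro _ ⟨x, hx, rfl⟩
      exact ⟨Pi.single (b.symm ⟨x, hx⟩) 1, by rw [hTs]; simp⟩
    obtain ⟨y, hy⟩ := h2 h1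
    rw [← hy, hLT]
  · exact ⟨b i, hI.subset_ground (b i).2, by simp only [← hTs, hLT]⟩

end Represents

/-! ### Vectors of a systematic representation -/

section Columns
open Finset

/-- The combinatorial core. Let `S` consist of the unit vectors of `𝔽₂ᵏ` and of `m ≥ 3` further
vectors, such that each coordinate and each sum of two coordinates is nonzero on at least `m` of
the vectors. Let `z i` be the set of non-unit vectors in `S` whose `i`-th coordinate vanishes.
The hypotheses say that `z i` has at most one element and that the symmetric difference of
`z i` and `z j` has at least `m - 2` elements, so only few values of `k` and `m` remain. -/
lemma parameters_of_weights {k m : ℕ} (S : Finset (Fin k → ZMod 2)) (h0 : 0 ∉ S)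
    (hu : ∀ i, Pi.single i 1 ∈ S) (hcard : #S = k + m)
    (h1 : ∀ i, m ≤ #{s ∈ S | s i ≠ 0}) (h2 : ∀ i j, i ≠ j → m ≤ #{s ∈ S | s i ≠ s j})
    (hm : 3 ≤ m) :
    3 ≤ k ∧ k ≤ 4 ∧ m ≤ 4 ∧
      (k = 4 → ∀ s ∈ S, ∃ i, s = Pi.single i 1 ∨ s = 1 - Pi.single i 1) := by
  classical
  have hk : 3 ≤ k := by
    have hle : #S ≤ #((univ : Finset (Fin k → ZMod 2)).erase 0) :=
      card_le_card fun s hs => mem_erase.2 ⟨fun h => h0 (h ▸ hs), mem_univ _⟩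
    rw [card_erase_of_mem (mem_univ _), card_univ, Fintype.card_fun, ZMod.card, Fintype.card_fin,
      hcard] at hle
    by_contra! hk
    interval_cases k <;> omega
  set U : Finset (Fin k → ZMod 2) := univ.image fun i => Pi.single i 1 with hU
  have hsingle : Function.Injective fun i : Fin k => (Pi.single i 1 : Fin k → ZMod 2) := by
    intro i j hij
    by_contra hne
    have := congrFun hij i
    simp [Pi.single_eq_of_ne hne] at this
  have hUS : U ⊆ S := by
    intro s hs
    obtain ⟨i, -, rfl⟩ := mem_image.1 hs
    exact hu i
  have hUcard : #U = k := by
    rw [hU, card_image_of_injective _ hsingle, card_univ, Fintype.card_fin]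
  set B := S \ U with hB
  have hBcard : #B = m := by
    have := card_sdiff_add_card_eq_card hUS
    rw [← hB] at this
    omega
  have hSB : ∀ s ∈ S, s ∈ B ∨ ∃ i, s = Pi.single i 1 := by
    intro s hs
    by_cases hsU : s ∈ U
    · obtain ⟨i, -, rfl⟩ := mem_image.1 hsU
      exact Or.inr ⟨i, rfl⟩
    · exact Or.inl (mem_sdiff.2 ⟨hs, hsU⟩)
  let z : Fin k → Finset (Fin k → ZMod 2) := fun i => {b ∈ B | b i = 0}
  have hz1 : ∀ i, #(z i) ≤ 1 := by
    intro i
    have hsub : ({s ∈ S | s i ≠ 0} : Finset _) ⊆ insert (Pi.single i 1) {b ∈ B | ¬ b i = 0} := by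
      intro s hs
      obtain ⟨hs, hsi⟩ := mem_filter.1 hs
      rcases hSB s hs with h | ⟨j, rfl⟩
      · exact mem_insert_of_mem (mem_filter.2 ⟨h, hsi⟩)
      · rcases eq_or_ne i j with rfl | hij
        · exact mem_insert_self _ _
        · exact absurd (Pi.single_eq_of_ne hij _) hsi
    have h3 := (h1 i).trans ((card_le_card hsub).trans (card_insert_le _ _))
    have h4 := card_filter_add_card_filter_not (s := B) (fun b => b i = 0)
    change #(z i) + _ = _ at h4
    omega
  have hz2 : ∀ i j, i ≠ j → m ≤ #(z i \ z j) + #(z j \ z i) + 2 := by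
    intro i j hij
    have hsub : ({s ∈ S | s i ≠ s j} : Finset _) ⊆
        ((z i \ z j) ∪ (z j \ z i)) ∪ {Pi.single i 1, Pi.single j 1} := by
      intro s hs
      obtain ⟨hs, hsij⟩ := mem_filter.1 hs
      rcases hSB s hs with h | ⟨l, rfl⟩
      · have h01 : ∀ a b : ZMod 2, a ≠ b → (a = 0 ∧ b ≠ 0) ∨ (b = 0 ∧ a ≠ 0) := by decide
        have := h01 _ _ hsij
        simp only [z, mem_union, mem_sdiff, mem_filter, h, true_and]
        tauto
      · rcases eq_or_ne i l with rfl | hil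
        · simp
        · rcases eq_or_ne j l with rfl | hjl
          · simp
          · exact absurd (by rw [Pi.single_eq_of_ne hil, Pi.single_eq_of_ne hjl]) hsij
    have h3 := (h2 i j hij).trans ((card_le_card hsub).trans (card_union_le _ _))
    have h4 := card_union_le (z i \ z j) (z j \ z i)
    have h5 : #({Pi.single i 1, Pi.single j 1} : Finset (Fin k → ZMod 2)) ≤ 2 := card_le_two
    omega
  have hz3 : ∀ i j, #(z i \ z j) ≤ #(z i) := fun i j => card_le_card sdiff_subset
  have hzinj : Function.Injective z := by
    intro i j hij
    by_contra hne
    have := hz2 i j hne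
    rw [hij] at this
    simp at this
    omega
  have hm4 : m ≤ 4 := by
    have := hz2 ⟨0, by omega⟩ ⟨1, by omega⟩ (by simp)
    have := hz3 ⟨0, by omega⟩ ⟨1, by omega⟩
    have := hz3 ⟨1, by omega⟩ ⟨0, by omega⟩
    have := hz1 ⟨0, by omega⟩
    have := hz1 ⟨1, by omega⟩
    omega
  -- There are four candidates for the sets `z i`: for `m = 3` the empty set and three singletons,
  -- for `m = 4` four singletons.
  obtain ⟨P, hPz, hPB, hP⟩ : ∃ P : Finset (Finset (Fin k → ZMod 2)),
      (∀ i, z i ∈ P) ∧ (∀ b ∈ B, {b} ∈ P) ∧ #P ≤ 4 := by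
    have hzB : ∀ i, z i ⊆ B := fun i => filter_subset _ _
    rcases (show m = 3 ∨ m = 4 by omega) with rfl | rfl
    · refine ⟨insert ∅ (B.powersetCard 1), fun i => ?_, fun b hb => ?_, ?_⟩
      · rcases Nat.le_one_iff_eq_zero_or_eq_one.1 (hz1 i) with h | h
        · rw [card_eq_zero.1 h]
          exact mem_insert_self _ _
        · exact mem_insert_of_mem (mem_powersetCard.2 ⟨hzB i, h⟩)
      · exact mem_insert_of_mem (mem_powersetCard.2 ⟨singleton_subset_iff.2 hb, card_singleton _⟩)
      · refine (card_insert_le _ _).trans ?_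
        rw [card_powersetCard, hBcard]
        decide
    · refine ⟨B.powersetCard 1, fun i => ?_, fun b hb => ?_, ?_⟩
      · obtain ⟨j, hj⟩ : ∃ j, i ≠ j := by
          have : Nontrivial (Fin k) := Fin.nontrivial_iff_two_le.2 (by omega)
          obtain ⟨j, hj⟩ := exists_ne i
          exact ⟨j, hj.symm⟩
        have := hz2 i j hj
        have := hz3 i j
        have := hz3 j i
        have := hz1 i
        have := hz1 j
        exact mem_powersetCard.2 ⟨hzB i, by omega⟩
      · exact mem_powersetCard.2 ⟨singleton_subset_iff.2 hb, card_singleton _⟩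
      · rw [card_powersetCard, hBcard]
        decide
  have himg : univ.image z ⊆ P := by
    intro t ht
    obtain ⟨i, -, rfl⟩ := mem_image.1 ht
    exact hPz i
  have himgcard : #(univ.image z) = k := by
    rw [card_image_of_injective _ hzinj, card_univ, Fintype.card_fin]
  refine ⟨hk, himgcard ▸ (card_le_card himg).trans hP, hm4, fun hk4 s hs => ?_⟩
  rcases hSB s hs with h | ⟨i, rfl⟩
  · have : {s} ∈ univ.image z := by
      rw [eq_of_subset_of_card_le himg (by omega)]
      exact hPB s h
    obtain ⟨i, -, hi⟩ := mem_image.1 this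
    refine ⟨i, Or.inr (funext fun j => ?_)⟩
    have hsj : s j = 0 ↔ i = j := by
      rw [show s j = 0 ↔ s ∈ z j from by simp [z, h]]
      constructor
      · intro hj
        have : z j = z i := by
          rw [hi]
          exact (card_le_one_iff_subset_singleton.1 (hz1 j)).elim fun a ha => by
            have := mem_singleton.1 (ha hj)
            exact eq_singleton_iff_unique_mem.2
              ⟨hj, fun x hx => (mem_singleton.1 (ha hx)).trans this.symm⟩
        exact (hzinj this).symm
      · rintro rfl
        rw [hi]
        exact mem_singleton_self s
    rcases eq_or_ne i j with rfl | hij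
    · simp [hsj.2 rfl]
    · have h01 : ∀ a : ZMod 2, a ≠ 0 → a = 1 := by decide
      rw [h01 _ (mt hsj.1 hij), Pi.sub_apply, Pi.single_eq_of_ne hij.symm]
      simp
  · exact ⟨i, Or.inl rfl⟩

end Columns

/-! ### Minimum distance -/

section Distance
variable {α : Type*} {M : Matroid α} {X : Set α}

lemma minDist_le (hX : X ⊆ M.E) (h : M.rho (M.E \ X) < M.rho M.E) : M.minDist ≤ X.encard :=
  sInf_le ⟨X, hX, h, rfl⟩

lemma le_minDist [M.Finite] {d : ℕ}
    (h : ∀ X ⊆ M.E, M.rho (M.E \ X) < M.rho M.E → d ≤ X.ncard) : (d : ℕ∞) ≤ M.minDist := by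
  refine le_sInf ?_
  rintro _ ⟨X, hX, hlt, rfl⟩
  rw [← (M.ground_finite.subset hX).cast_ncard_eq]
  exact_mod_cast h X hX hlt

/-- The Singleton bound: the minimum distance exceeds the nullity by at most one. -/
lemma minDist_le_nullity_add_one [M.Finite] (h : 0 < M.rho M.E) {m : ℕ}
    (hm : M.E.ncard = M.rho M.E + m) : M.minDist ≤ (m + 1 : ℕ) := by
  obtain ⟨I, hI⟩ := M.exists_isBase
  have hIE := hI.subset_ground
  have hIr : I.ncard = M.rho M.E := by
    rw [← (indep_iff_rho hIE).1 hI.indep, ← rho_closure _ I, hI.closure_eq]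
  have hIf := M.ground_finite.subset hIE
  obtain ⟨e, he⟩ := Set.nonempty_of_ncard_ne_zero (s := I) (by omega)
  have h1 := Set.ncard_sdiff_singleton_add_one he hIf
  have hJE : I \ {e} ⊆ M.E := Set.sdiff_subset.trans hIE
  have h2 := rho_le_ncard hJE
  have h3 := Set.ncard_sdiff_add_ncard_of_subset hJE M.ground_finite
  have h4 : M.E \ (M.E \ (I \ {e})) = I \ {e} := Set.sdiff_sdiff_cancel_left hJE
  refine (minDist_le (X := M.E \ (I \ {e})) Set.sdiff_subset (by rw [h4]; omega)).trans ?_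
  rw [← (M.ground_finite.subset Set.sdiff_subset).cast_ncard_eq]
  exact_mod_cast (by omega)

end Distance

/-! ### Matroids given by a list of columns -/

section Identification
open Finset
variable {α : Type*} {M : Matroid α} {k n : ℕ}

lemma Represents.mulVec {w : α → Fin k → ZMod 2} (hw : M.Represents w)
    {A B : Matrix (Fin k) (Fin k) (ZMod 2)} (hAB : A * B = 1) (hBA : B * A = 1) :
    M.Represents fun e => A.mulVec (w e) := by
  refine hw.of_injective B.mulVecLin (fun x y hxy => ?_) fun e _ => ?_
  · have := congrArg A.mulVec hxy
    simpa [hAB] using this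
  · simp [hBA]

/-- The set `T` of columns of `G` is the support of a relation, is neither empty nor everything,
and each column outside it is separated from it by a row vector `a`. For a matroid of height
three these are the cyclic flats other than the bottom and the top. -/
def IsMiddleFlat (G : Matrix (Fin k) (Fin n) (ZMod 2)) (T : Finset (Fin n)) : Prop :=
  (∀ j, ∑ i ∈ T, G j i = 0) ∧ T ≠ ∅ ∧ T ≠ univ ∧
    ∀ e ∉ T, ∃ a : Fin k → ZMod 2, (∀ x ∈ T, ∑ j, a j * G j x = 0) ∧ ∑ j, a j * G j e ≠ 0

instance (G : Matrix (Fin k) (Fin n) (ZMod 2)) : DecidablePred (IsMiddleFlat G) :=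
  fun _ => inferInstanceAs (Decidable (_ ∧ _))

/-- Elements whose vectors are the columns of `G` can be labelled by the column indices. -/
lemma exists_labelling {w : α → Fin k → ZMod 2} (hw : Set.InjOn w M.E)
    {G : Matrix (Fin k) (Fin n) (ZMod 2)} (hG : Function.Injective G.col)
    (himg : w '' M.E = Set.range G.col) :
    ∃ g : Fin n ↪ α, Set.range g = M.E ∧ ∀ i, w (g i) = G.col i := by
  have h1 : ∀ i, ∃ e ∈ M.E, w e = G.col i := fun i => by
    have : G.col i ∈ w '' M.E := himg ▸ Set.mem_range_self i
    exact this
  choose g hg hwg using h1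
  refine ⟨⟨g, fun i j hij => hG ?_⟩, ?_, hwg⟩
  · rw [← hwg, ← hwg, hij]
  · refine Set.Subset.antisymm (by rintro _ ⟨i, rfl⟩; exact hg i) fun e he => ?_
    obtain ⟨i, hi⟩ : w e ∈ Set.range G.col := himg ▸ Set.mem_image_of_mem w he
    exact ⟨i, hw (hg i) he ((hwg i).trans hi)⟩

lemma Represents.isomorphic_ofMatrix {w : α → Fin k → ZMod 2} (hw : M.Represents w)
    {G : Matrix (Fin k) (Fin n) (ZMod 2)} (g : Fin n ↪ α) (hg : Set.range g = M.E)
    (hwg : ∀ i, w (g i) = G.col i) : M.Isomorphic (ofMatrix G) := by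
  let φ : Fin n ≃ M.E := (Equiv.ofInjective g g.injective).trans (Equiv.setCongr hg)
  refine ⟨φ.symm.trans (Equiv.Set.univ (Fin n)).symm, fun X => ?_⟩
  rw [ofMatrix_rho, hw _ (by rintro _ ⟨x, -, rfl⟩; exact x.2)]
  refine congrArg (fun S => Module.finrank (ZMod 2) (Submodule.span (ZMod 2) S)) ?_
  have hφ : ∀ x : M.E, G.col (φ.symm x) = w x := fun x => by
    rw [← hwg]
    exact congrArg (fun y : M.E => w y) (φ.apply_symm_apply x)
  ext y
  constructor
  · rintro ⟨_, ⟨_, ⟨x, hx, rfl⟩, rfl⟩, rfl⟩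
    exact ⟨x, ⟨x, hx, rfl⟩, (hφ x).symm⟩
  · rintro ⟨_, ⟨x, hx, rfl⟩, rfl⟩
    exact ⟨_, ⟨_, ⟨x, hx, rfl⟩, rfl⟩, hφ x⟩

lemma Represents.numAtoms_eq_card [M.Finite] {w : α → Fin k → ZMod 2} (hw : M.Represents w)
    (hs : M.IsSimple) (hcol : ∀ e, ¬ M.IsColoop e) (hh : M.cyclicFlatsHeight = 3)
    (hcirc : ∀ Z, M.IsCyclicFlat Z → Z.Nonempty → Z ≠ M.E → M.IsCircuit Z)
    {G : Matrix (Fin k) (Fin n) (ZMod 2)} (g : Fin n ↪ α) (hg : Set.range g = M.E)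
    (hwg : ∀ i, w (g i) = G.col i) : M.numAtoms = #{T | IsMiddleFlat G T} := by
  classical
  have hcoe : ∀ T : Finset (Fin n), ((T.map g : Finset α) : Set α) ⊆ M.E := fun T => by
    rw [coe_map, ← hg]
    exact Set.image_subset_range _ _
  have hfun : ∀ (φ : (Fin k → ZMod 2) →ₗ[ZMod 2] ZMod 2) i,
      φ (w (g i)) = ∑ j, φ (Pi.single j 1) * G j i := fun φ i => by
    rw [hwg, LinearMap.pi_apply_eq_sum_univ φ]
    refine sum_congr rfl fun j _ => ?_
    rw [smul_eq_mul, mul_comm, Matrix.col_apply]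
    congr 2
    ext l
    simp [Pi.single_apply, eq_comm]
  have key : ∀ T : Finset (Fin n), IsMiddleFlat G T ↔
      (M.IsCyclicFlat ((T.map g : Finset α) : Set α) ∧
        ((T.map g : Finset α) : Set α).Nonempty ∧ ((T.map g : Finset α) : Set α) ≠ M.E) := by
    intro T
    rw [hw.isCyclicFlat_iff_of_forall_isCircuit hcirc _ (hcoe T)]
    refine and_congr ?_ (and_congr ?_ (and_congr ?_ ?_))
    · rw [sum_map, funext_iff]
      simp [hwg]
    · rw [coe_nonempty, map_nonempty, nonempty_iff_ne_empty]
    · rw [coe_map, ← hg, ← Set.image_univ, Ne, Ne, (Set.image_injective.2 g.injective).eq_iff,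
        coe_eq_univ]
    · rw [← hg, Set.forall_mem_range]
      refine forall_congr' fun e => ?_
      rw [mem_map']
      refine imp_congr_right fun _ => ?_
      constructor
      · rintro ⟨a, ha, hae⟩
        refine ⟨Fintype.linearCombination (ZMod 2) a, fun x hx => ?_, ?_⟩
        · obtain ⟨i, hi, rfl⟩ := mem_map.1 hx
          rw [hfun]
          simpa [Fintype.linearCombination_apply_single] using ha i hi
        · rw [hfun]
          simpa [Fintype.linearCombination_apply_single] using hae
      · rintro ⟨φ, hφ, hφe⟩
        refine ⟨fun j => φ (Pi.single j 1), fun x hx => ?_, ?_⟩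
        · rw [← hfun]
          exact hφ _ (mem_map_of_mem g hx)
        · rwa [← hfun]
  have hinj : Function.Injective fun T : Finset (Fin n) => ((T.map g : Finset α) : Set α) :=
    fun S T h => map_injective g (coe_injective h)
  rw [numAtoms_eq hs hcol hh, ← Set.ncard_coe_finset, ← Set.ncard_image_of_injective _ hinj]
  congr 1
  ext Z
  constructor
  · rintro ⟨h1, h2, h3⟩
    have hZ : ((({i | g i ∈ Z} : Finset (Fin n)).map g : Finset α) : Set α) = Z := by
      rw [coe_map, coe_filter]
      simp only [mem_univ, true_and]
      exact Set.image_preimage_eq_of_subset (hg ▸ h1.1.subset_ground)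
    refine ⟨({i | g i ∈ Z} : Finset (Fin n)), ?_, hZ⟩
    rw [mem_coe, mem_filter, key, hZ]
    exact ⟨mem_univ _, h1, h2, h3⟩
  · rintro ⟨T, hT, rfl⟩
    exact (key T).1 (mem_filter.1 hT).2

/-- A simple matroid represented by the columns of `G` is the matroid of `G`. The distance is at
least the nullity `m`, hence equal to it if some row of `G` has weight `m`. -/
lemma Represents.identify [M.Finite] {w : α → Fin k → ZMod 2} (hw : M.Represents w)
    (hs : M.IsSimple) (hcol : ∀ e, ¬ M.IsColoop e) (hh : M.cyclicFlatsHeight = 3)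
    (hcirc : ∀ Z, M.IsCyclicFlat Z → Z.Nonempty → Z ≠ M.E → M.IsCircuit Z)
    {m : ℕ} (hk : M.rho M.E = k) (hm : M.E.ncard = k + m)
    {G : Matrix (Fin k) (Fin n) (ZMod 2)} (hG : Function.Injective G.col)
    (himg : w '' M.E = Set.range G.col) (i : Fin k) (hi : #{j | G i j ≠ 0} = m) (hm0 : m ≠ 0) :
    M.Isomorphic (ofMatrix G) ∧ M.HasParameters n k m ∧
      M.numAtoms = #{T | IsMiddleFlat G T} := by
  classical
  obtain ⟨g, hg, hwg⟩ := exists_labelling (hw.injOn hs) hG himg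
  refine ⟨hw.isomorphic_ofMatrix g hg hwg, ⟨?_, hk, le_antisymm ?_ (le_minDist fun X hX hlt => ?_)⟩,
    hw.numAtoms_eq_card hs hcol hh hcirc g hg hwg⟩
  · rw [← hg, ← Set.image_univ, Set.ncard_image_of_injective _ g.injective, Set.ncard_univ,
      Nat.card_eq_fintype_card, Fintype.card_fin]
  · obtain ⟨j, hj⟩ := card_pos.1 (Nat.pos_of_ne_zero (hi ▸ hm0 : #{j | G i j ≠ 0} ≠ 0))
    have hwi : ∀ j, (LinearMap.proj i : (Fin k → ZMod 2) →ₗ[ZMod 2] ZMod 2) (w (g j)) = G i j :=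
      fun j => by simp [hwg]
    have hlt := hw.rho_lt_of_functional (LinearMap.proj i) (e := g j) (hg ▸ Set.mem_range_self j)
      (by rw [hwi]; exact (mem_filter.1 hj).2)
    refine (minDist_le (Set.sep_subset _ _) hlt).trans (le_of_eq ?_)
    have hX : {x ∈ M.E | (LinearMap.proj i : (Fin k → ZMod 2) →ₗ[ZMod 2] ZMod 2) (w x) ≠ 0} =
        ((({j | G i j ≠ 0} : Finset (Fin n)).map g : Finset α) : Set α) := by
      ext x
      rw [Set.mem_sep_iff, ← hg, mem_coe, mem_map]
      constructor
      · rintro ⟨⟨j, rfl⟩, h⟩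
        exact ⟨j, mem_filter.2 ⟨mem_univ _, by rwa [← hwi]⟩, rfl⟩
      · rintro ⟨j, hj, rfl⟩
        exact ⟨⟨j, rfl⟩, by rw [hwi]; exact (mem_filter.1 hj).2⟩
    rw [hX, Set.encard_coe_eq_coe_finsetCard, card_map, hi]
  · have := ncard_ground_le_of_rho_lt hcirc hX hlt
    omega

end Identification

/-! ### The four matrices -/

section SmallCases
open Finset

/-- The generator matrix of `matroid633`. -/
def matrix633 : Matrix (Fin 3) (Fin 6) (ZMod 2) :=
  !![1, 0, 0, 1, 1, 1;
     0, 1, 0, 1, 0, 1;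
     0, 0, 1, 0, 1, 1]

/-- The generator matrix of `simplexMatroid`. -/
def simplexMatrix : Matrix (Fin 3) (Fin 7) (ZMod 2) :=
  !![1, 0, 0, 1, 1, 0, 1;
     0, 1, 0, 1, 0, 1, 1;
     0, 0, 1, 0, 1, 1, 1]

/-- The generator matrix of `hammingMatroid`. -/
def hammingMatrix : Matrix (Fin 4) (Fin 7) (ZMod 2) :=
  !![1, 0, 0, 0, 1, 1, 0;
     0, 1, 0, 0, 1, 0, 1;
     0, 0, 1, 0, 0, 1, 1;
     0, 0, 0, 1, 1, 1, 1]

/-- The generator matrix of `reedMullerMatroid`. -/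
def reedMullerMatrix : Matrix (Fin 4) (Fin 8) (ZMod 2) :=
  !![1, 0, 0, 0, 1, 0, 1, 1;
     0, 1, 0, 0, 1, 1, 0, 1;
     0, 0, 1, 0, 1, 1, 1, 0;
     0, 0, 0, 1, 0, 1, 1, 1]

/-- The linear group of `𝔽₂³` can move a nonzero vector `p` that is not a unit vector to
`(0, 1, 1)`, the nonzero vector missing from the columns of the `(6, 3, 3)`-matroid. -/
lemma exists_matrix_image_erase (p : Fin 3 → ZMod 2) (hp : p ≠ 0)
    (hu : ∀ i, p ≠ Pi.single i 1) :
    ∃ A B : Matrix (Fin 3) (Fin 3) (ZMod 2), A * B = 1 ∧ B * A = 1 ∧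
      ((univ.erase 0).erase p).image A.mulVec = (univ.erase 0).erase ![0, 1, 1] := by
  have h : ∀ p : Fin 3 → ZMod 2, p ≠ 0 → (∀ i, p ≠ Pi.single i 1) →
      p = ![1, 1, 0] ∨ p = ![1, 0, 1] ∨ p = ![0, 1, 1] ∨ p = ![1, 1, 1] := by decide
  rcases h p hp hu with rfl | rfl | rfl | rfl
  · exact ⟨!![0, 0, 1; 0, 1, 0; 1, 0, 0], !![0, 0, 1; 0, 1, 0; 1, 0, 0], by decide +kernel,
      by decide +kernel, by decide +kernel⟩
  · exact ⟨!![0, 1, 0; 1, 0, 0; 0, 0, 1], !![0, 1, 0; 1, 0, 0; 0, 0, 1], by decide +kernel,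
      by decide +kernel, by decide +kernel⟩
  · exact ⟨1, 1, by decide +kernel, by decide +kernel, by decide +kernel⟩
  · exact ⟨!![1, 1, 0; 1, 0, 0; 0, 0, 1], !![0, 1, 0; 1, 1, 0; 0, 0, 1], by decide +kernel,
      by decide +kernel, by decide +kernel⟩

/-- The unit vectors of `𝔽₂⁴` and their complements. -/
def unitsAndComplements : Finset (Fin 4 → ZMod 2) :=
  univ.image (fun i => Pi.single i 1) ∪ univ.image fun i => 1 - Pi.single i 1

/-- Permuting coordinates moves the complement of the `i`-th unit vector to the complement of the
last one, the vector missing from the columns of the Hamming matroid. -/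
lemma exists_matrix_image_unitsAndComplements (i : Fin 4) :
    ∃ A B : Matrix (Fin 4) (Fin 4) (ZMod 2), A * B = 1 ∧ B * A = 1 ∧
      (unitsAndComplements.erase (1 - Pi.single i 1)).image A.mulVec =
        unitsAndComplements.erase ![1, 1, 1, 0] := by
  refine ⟨Matrix.of fun a b => if Equiv.swap i 3 a = b then 1 else 0,
    Matrix.of fun a b => if Equiv.swap i 3 a = b then 1 else 0, ?_⟩
  revert i
  decide +kernel

lemma exists_eq_erase {β : Type*} [DecidableEq β] {S T : Finset β} (h : S ⊆ T)
    (hc : #T = #S + 1) : ∃ p ∈ T, S = T.erase p := by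
  obtain ⟨p, hp, hpS⟩ := exists_of_ssubset (h.ssubset_of_ne fun h => by rw [h] at hc; omega)
  refine ⟨p, hp, eq_of_subset_of_card_le (subset_erase.2 ⟨h, hpS⟩) ?_⟩
  rw [card_erase_of_mem hp]
  omega

end SmallCases

/-! ### Classification for nullity at least three -/

section Classification
open Finset
variable {α : Type*} {M : Matroid α}

/-- If the nullity `m` is at least three, the vectors of a systematic representation are, up to an
invertible matrix, the columns of one of the four matrices. -/
lemma classification_of_three_le [M.Finite] (hs : M.IsSimple)
    (hcol : ∀ e, ¬ M.IsColoop e) (hh : M.cyclicFlatsHeight = 3)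
    (hcirc : ∀ Z, M.IsCyclicFlat Z → Z.Nonempty → Z ≠ M.E → M.IsCircuit Z) {k m : ℕ}
    {w : α → Fin k → ZMod 2} (hw : M.Represents w)
    (hu : ∀ i, ∃ e ∈ M.E, w e = Pi.single i 1) (hk : M.rho M.E = k) (hm : M.E.ncard = k + m)
    (h3 : 3 ≤ m) :
    (M.Isomorphic matroid633 ∧ M.HasParameters 6 3 3 ∧ M.numAtoms = 4) ∨
    (M.Isomorphic simplexMatroid ∧ M.HasParameters 7 3 4 ∧ M.numAtoms = 7) ∨
    (M.Isomorphic hammingMatroid ∧ M.HasParameters 7 4 3 ∧ M.numAtoms = 7) ∨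
    (M.Isomorphic reedMullerMatroid ∧ M.HasParameters 8 4 4 ∧ M.numAtoms = 14) := by
  classical
  obtain ⟨S, hS⟩ := (M.ground_finite.image w).exists_finset_coe
  have hwinj := hw.injOn hs
  have hcard : #S = k + m := by
    rw [← hm, ← Set.ncard_coe_finset, hS, hwinj.ncard_image]
  have h0 : ∀ s ∈ S, s ≠ 0 := by
    intro s hs'
    obtain ⟨e, he, rfl⟩ : s ∈ w '' M.E := hS ▸ hs'
    exact hw.ne_zero hs he
  have huS : ∀ i, Pi.single i 1 ∈ S := by
    intro i
    obtain ⟨e, he, hi⟩ := hu i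
    rw [← mem_coe, hS, ← hi]
    exact Set.mem_image_of_mem w he
  have hwt : ∀ (φ : (Fin k → ZMod 2) →ₗ[ZMod 2] ZMod 2) i, φ (Pi.single i 1) ≠ 0 →
      m ≤ #{s ∈ S | φ s ≠ 0} := by
    intro φ i hφ
    obtain ⟨e, he, hi⟩ := hu i
    have h1 := ncard_ground_le_of_rho_lt hcirc (Set.sep_subset _ _)
      (hw.rho_lt_of_functional φ he (by rwa [hi]))
    have h2 : w '' {x ∈ M.E | φ (w x) ≠ 0} = (({s ∈ S | φ s ≠ 0} : Finset _) : Set _) := by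
      ext s
      rw [coe_filter, Set.mem_ofPred_eq, ← mem_coe, hS]
      constructor
      · rintro ⟨x, ⟨hx, hφx⟩, rfl⟩
        exact ⟨⟨x, hx, rfl⟩, hφx⟩
      · rintro ⟨⟨x, hx, rfl⟩, hφx⟩
        exact ⟨x, ⟨hx, hφx⟩, rfl⟩
    rw [← (hwinj.mono (Set.sep_subset _ _)).ncard_image, h2,
      Set.ncard_coe_finset] at h1
    omega
  obtain ⟨hk3, hk4, hm4, hT⟩ := parameters_of_weights S (fun h => h0 _ h rfl) huS hcard
    (fun i => hwt (LinearMap.proj i) i (by simp))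
    (fun i j hij => by
      let π : Fin k → (Fin k → ZMod 2) →ₗ[ZMod 2] ZMod 2 := LinearMap.proj
      let φ := π i - π j
      have hφ : ∀ s, φ s = s i - s j := fun s => rfl
      have := hwt φ i (by simp [hφ, Pi.single_eq_of_ne hij.symm])
      simpa only [hφ, sub_ne_zero] using this) h3
  have hm' : m = 3 ∨ m = 4 := by omega
  have hk' : k = 3 ∨ k = 4 := by omega
  -- A change of coordinates by an invertible matrix, followed by `Represents.identify`.
  have key : ∀ {n a : ℕ} (G : Matrix (Fin k) (Fin n) (ZMod 2))
      (A B : Matrix (Fin k) (Fin k) (ZMod 2)), A * B = 1 → B * A = 1 →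
      S.image A.mulVec = univ.image G.col → Function.Injective G.col →
      (∃ i, #{j | G i j ≠ 0} = m) → #{T | IsMiddleFlat G T} = a →
      M.Isomorphic (ofMatrix G) ∧ M.HasParameters n k m ∧ M.numAtoms = a := by
    rintro n a G A B hAB hBA himg hG ⟨i, hi⟩ rfl
    refine (hw.mulVec hAB hBA).identify hs hcol hh hcirc hk hm hG ?_ i hi (by omega)
    have := congrArg (fun F : Finset (Fin k → ZMod 2) => (F : Set (Fin k → ZMod 2))) himg
    simpa [hS, Set.image_image] using this
  rcases hk' with rfl | rfl
  · have hsub : S ⊆ univ.erase 0 := fun s hs' => mem_erase.2 ⟨h0 s hs', mem_univ _⟩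
    have hc : #((univ : Finset (Fin 3 → ZMod 2)).erase 0) = 7 := by decide +kernel
    rcases hm' with rfl | rfl
    · obtain ⟨p, hp, rfl⟩ := exists_eq_erase hsub (by omega)
      obtain ⟨A, B, hAB, hBA, himg⟩ := exists_matrix_image_erase p (mem_erase.1 hp).1
        fun i h => (mem_erase.1 (huS i)).1 h.symm
      exact Or.inl (key matrix633 A B hAB hBA (himg.trans (by decide +kernel))
        (by decide +kernel) ⟨1, by decide +kernel⟩ (by decide +kernel))
    · obtain rfl := eq_of_subset_of_card_le hsub (by omega)
      exact Or.inr (Or.inl (key simplexMatrix 1 1 (one_mul 1) (one_mul 1) (by decide +kernel)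
        (by decide +kernel) ⟨0, by decide +kernel⟩ (by decide +kernel)))
  · have hsub : S ⊆ unitsAndComplements := by
      intro s hs'
      obtain ⟨i, h | h⟩ := hT rfl s hs'
      · exact mem_union_left _ (mem_image.2 ⟨i, mem_univ _, h.symm⟩)
      · exact mem_union_right _ (mem_image.2 ⟨i, mem_univ _, h.symm⟩)
    have hc : #unitsAndComplements = 8 := by decide +kernel
    rcases hm' with rfl | rfl
    · obtain ⟨p, hp, rfl⟩ := exists_eq_erase hsub (by omega)
      obtain ⟨i, rfl⟩ : ∃ i, p = 1 - Pi.single i 1 := by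
        rcases mem_union.1 hp with h | h
        · obtain ⟨i, -, rfl⟩ := mem_image.1 h
          exact absurd rfl (mem_erase.1 (huS i)).1
        · obtain ⟨i, -, rfl⟩ := mem_image.1 h
          exact ⟨i, rfl⟩
      obtain ⟨A, B, hAB, hBA, himg⟩ := exists_matrix_image_unitsAndComplements i
      exact Or.inr (Or.inr (Or.inl (key hammingMatrix A B hAB hBA
        (himg.trans (by decide +kernel)) (by decide +kernel) ⟨0, by decide +kernel⟩
        (by decide +kernel))))
    · obtain rfl := eq_of_subset_of_card_le hsub (by omega)
      exact Or.inr (Or.inr (Or.inr (key reedMullerMatrix 1 1 (one_mul 1) (one_mul 1)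
        (by decide +kernel) (by decide +kernel) ⟨0, by decide +kernel⟩ (by decide +kernel))))

/-- In a simple binary matroid of height three, the nonempty proper cyclic flats are circuits. -/
lemma isCircuit_of_isCyclicFlat [M.Finite] {V : Type*} [AddCommGroup V] [Module (ZMod 2) V]
    [Module.Finite (ZMod 2) V] {v : α → V} (hv : M.Represents v) (hs : M.IsSimple)
    (hcol : ∀ e, ¬ M.IsColoop e) (hh : M.cyclicFlatsHeight = 3) {Z : Set α}
    (hZ : M.IsCyclicFlat Z) (hne : Z.Nonempty) (hZE : Z ≠ M.E) : M.IsCircuit Z :=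
  hv.isCircuit_of_minimal hs hZ hne fun _ hY hYZ hYne =>
    eq_of_isCyclicFlat_subset hs hcol hh hY hZ hYZ hYne hZE

end Classification

end Matroid

theorem mainTheorem5 {α : Type*} (M : Matroid α) [M.Finite]
    (hbinary : M.IsBinary) (hsimple : M.IsSimple)
    (histhmus : ∀ e, ¬ M.IsColoop e)
    (hheight : M.cyclicFlatsHeight = 3) :
    (M.eta M.E = 2 ∨
      (M.Isomorphic Matroid.matroid633 ∧ M.HasParameters 6 3 3 ∧ M.numAtoms = 4) ∨
      (M.Isomorphic Matroid.simplexMatroid ∧ M.HasParameters 7 3 4 ∧ M.numAtoms = 7) ∨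
      (M.Isomorphic Matroid.hammingMatroid ∧ M.HasParameters 7 4 3 ∧ M.numAtoms = 7) ∨
      (M.Isomorphic Matroid.reedMullerMatroid ∧ M.HasParameters 8 4 4 ∧ M.numAtoms = 14)) ∧
    M.eta M.E ≤ 4 ∧ M.minDist ≤ 4 := by
  obtain ⟨r, v, hv⟩ := hbinary.exists_represents
  have hcirc : ∀ Z, M.IsCyclicFlat Z → Z.Nonempty → Z ≠ M.E → M.IsCircuit Z :=
    fun Z hZ hne hZE => Matroid.isCircuit_of_isCyclicFlat hv hsimple histhmus hheight hZ hne hZE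
  obtain ⟨Z, hZ, hne, hZE⟩ := Matroid.exists_isCyclicFlat hheight
  have h2 := Matroid.two_le_nullity histhmus hZ hne hZE
  obtain ⟨m, hm⟩ := Nat.exists_eq_add_of_le (show M.rho M.E ≤ M.E.ncard by omega)
  have heta : M.eta M.E = m := by
    unfold Matroid.eta
    omega
  rcases eq_or_ne m 2 with rfl | hm2
  · refine ⟨Or.inl heta, by omega, ?_⟩
    have hpos : 0 < M.rho M.E := by
      obtain ⟨e, he⟩ := hne
      have heE := hZ.1.subset_ground he
      have h1 := hsimple e heE e heE
      rw [Set.pair_eq_singleton, Matroid.indep_iff_rho (by simpa using heE),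
        Set.ncard_singleton] at h1
      have h3 := M.rho_le_rho (Set.singleton_subset_iff.2 heE)
      omega
    exact (Matroid.minDist_le_nullity_add_one hpos hm).trans (by decide)
  · obtain ⟨w, hw, hu⟩ := hv.exists_systematic rfl
    have h := Matroid.classification_of_three_le hsimple histhmus hheight hcirc hw hu rfl hm
      (by omega)
    have hbound : ∀ {n k d : ℕ}, M.HasParameters n k d → n ≤ k + 4 → d ≤ 4 →
        M.eta M.E ≤ 4 ∧ M.minDist ≤ 4 := by
      rintro n k d ⟨h1, h2, h3⟩ hn hd
      refine ⟨by omega, ?_⟩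
      rw [h3]
      exact_mod_cast hd
    refine ⟨Or.inr h, ?_⟩
    rcases h with h | h | h | h
    all_goals exact hbound h.2.1 (by decide) (by decide)
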